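/- Let $k$ be a field, $A$ an associative unital $k$-algebra with product $\mu$, and $C$ a coassociative counital $k$-coalgebra with coproduct $\Delta(c)=\sum c_{(1)}\otimes c_{(2)}$ and counit $\epsilon$; write $\otimes=\otimes_k$, $I$ for identity maps, and $\tau$ for the flip maps $\tau(v\otimes w)=w\otimes v$. Let $\psi\colon C\otimes A\to A\otimes C$ be a linear map such that $(A,C)_\psi$ is an entwining structure, i.e. $$\psi\circ(I_C\otimes\mu)=(\mu\otimes I_C)\circ(I_A\otimes\psi)\circ(\psi\otimes I_A),\qquad (I_A\otimes\Delta)\circ\psi=(\psi\otimes I_C)\circ(I_C\otimes\psi)\circ(\Delta\otimes I_A),$$ $$\psi(c\otimes 1)=1\otimes c\quad(c\in C),\qquad (I_A\otimes\epsilon)\circ\psi=\epsilon\otimes I_A,$$ where the two sides of the last equation are regarded as maps $C\otimes A\to A$. Suppose that $\psi$ is bijective. For $r,s,p,t\in k$ define linear maps $W\colon A\otimes A\to A\otimes A$ and $Z\colon C\otimes C\to C\otimes C$ by $$W(a\otimes b)=s\,ba\otimes 1+r\,1\otimes ba-s\,b\otimes a,$$ $$Z(c\otimes d)=t\,\epsilon(c)\sum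 d_{(1)}\otimes d_{(2)}+p\,\epsilon(d)\sum c_{(1)}\otimes c_{(2)}-p\,d\otimes c.$$ Let $q\in k$ be non-zero and take $r=t=q$ and $s=p=q^{-1}$. Put $R=W\circ\tau_{A,A}$ and $R'=Z\circ\tau_{C,C}$, and let $$T=R\oplus_\psi R'\colon (A\oplus C)\otimes(A\oplus C)\to(A\oplus C)\otimes(A\oplus C)$$ be the linear map given by $T|_{A\otimes A}=R$, $T|_{C\otimes C}=R'$ and, for all $a\in A$, $c\in C$, $$T(a\otimes c)=\psi^{-1}(a\otimes c),\qquad T(c\otimes a)=\psi(c\otimes a)+(q-q^{-1})\,c\otimes a.$$ Then $T$ is a $q$-Hecke operator: $T$ is invertible, it satisfies the braid equation $T_{12}\circ T_{23}\circ T_{12}=T_{23}\circ T_{12}\circ T_{23}$ on $(A\oplus C)^{\otimes 3}$, where $T_{12}=T\otimes I$ and $T_{23}=I\otimes T$, and $$(T+q^{-1}I)\circ(T-qI)=0.$$ -/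

import Mathlib

open scoped TensorProduct

noncomputable section

namespace YBEntwining

section YangBaxter

variable {k V : Type*} [Field k] [AddCommGroup V] [Module k V]

/-- `R₁₂ = R ⊗ I` on `V ⊗ V ⊗ V`. -/
def act12 (R : V ⊗[k] V →ₗ[k] V ⊗[k] V) : (V ⊗[k] V) ⊗[k] V →ₗ[k] (V ⊗[k] V) ⊗[k] V :=
  R.rTensor V

/-- `R₂₃ = I ⊗ R` on `V ⊗ V ⊗ V`. -/
def act23 (R : V ⊗[k] V →ₗ[k] V ⊗[k] V) : (V ⊗[k] V) ⊗[k] V →ₗ[k] (V ⊗[k] V) ⊗[k] V :=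
  (TensorProduct.assoc k V V V).symm.toLinearMap ∘ₗ R.lTensor V ∘ₗ
    (TensorProduct.assoc k V V V).toLinearMap

/-- An invertible linear map `R : V ⊗ V → V ⊗ V` satisfying the braid equation
`R₁₂ R₂₃ R₁₂ = R₂₃ R₁₂ R₂₃`. -/
structure IsYangBaxterOperator (R : V ⊗[k] V →ₗ[k] V ⊗[k] V) : Prop where
  bijective : Function.Bijective R
  braid : act12 R ∘ₗ act23 R ∘ₗ act12 R = act23 R ∘ₗ act12 R ∘ₗ act23 R

/-- A Yang–Baxter operator `R` with `(R + q⁻¹ I) (R - q I) = 0`. -/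
structure IsHeckeOperator (q : k) (R : V ⊗[k] V →ₗ[k] V ⊗[k] V) : Prop where
  isYangBaxterOperator : IsYangBaxterOperator R
  hecke : (R + q⁻¹ • LinearMap.id) ∘ₗ (R - q • LinearMap.id) = 0

end YangBaxter

section Entwining

variable {k A C : Type*} [Field k] [Ring A] [Algebra k A]
  [AddCommGroup C] [Module k C] [Coalgebra k C]

/-- `ψ : C ⊗ A → A ⊗ C` is an entwining map, i.e. `(A, C)_ψ` is an entwining structure. -/
structure IsEntwining (ψ : C ⊗[k] A →ₗ[k] A ⊗[k] C) : Prop where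
  /-- `ψ (I ⊗ μ) = (μ ⊗ I) (I ⊗ ψ) (ψ ⊗ I)` -/
  mul : ψ ∘ₗ (LinearMap.mul' k A).lTensor C =
    (LinearMap.mul' k A).rTensor C ∘ₗ (TensorProduct.assoc k A A C).symm.toLinearMap ∘ₗ
      ψ.lTensor A ∘ₗ (TensorProduct.assoc k A C A).toLinearMap ∘ₗ
      ψ.rTensor A ∘ₗ (TensorProduct.assoc k C A A).symm.toLinearMap
  /-- `(I ⊗ Δ) ψ = (ψ ⊗ I) (I ⊗ ψ) (Δ ⊗ I)` -/
  comul : (Coalgebra.comul (R := k) (A := C)).lTensor A ∘ₗ ψ =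
    (TensorProduct.assoc k A C C).toLinearMap ∘ₗ ψ.rTensor C ∘ₗ
      (TensorProduct.assoc k C A C).symm.toLinearMap ∘ₗ ψ.lTensor C ∘ₗ
      (TensorProduct.assoc k C C A).toLinearMap ∘ₗ
      (Coalgebra.comul (R := k) (A := C)).rTensor A
  /-- `ψ (I ⊗ ι) = ι ⊗ I` -/
  one : ∀ c : C, ψ (c ⊗ₜ[k] (1 : A)) = (1 : A) ⊗ₜ[k] c
  /-- `(I ⊗ ε) ψ = ε ⊗ I`, both sides with values in `A` -/
  counit : (TensorProduct.rid k A).toLinearMap ∘ₗ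
      (Coalgebra.counit (R := k) (A := C)).lTensor A ∘ₗ ψ =
    (TensorProduct.lid k A).toLinearMap ∘ₗ (Coalgebra.counit (R := k) (A := C)).rTensor A

end Entwining

section Operators

variable {k : Type*} [Field k]

/-- `W (a ⊗ b) = s (ba ⊗ 1) + r (1 ⊗ ba) - s (b ⊗ a)`. -/
def W (A : Type*) [Ring A] [Algebra k A] (r s : k) : A ⊗[k] A →ₗ[k] A ⊗[k] A :=
  s • ((TensorProduct.mk k A A).flip 1 ∘ₗ LinearMap.mul' k A ∘ₗ
      (TensorProduct.comm k A A).toLinearMap) +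
    r • (TensorProduct.mk k A A 1 ∘ₗ LinearMap.mul' k A ∘ₗ
      (TensorProduct.comm k A A).toLinearMap) -
    s • (TensorProduct.comm k A A).toLinearMap

theorem W_tmul {A : Type*} [Ring A] [Algebra k A] (r s : k) (a b : A) :
    W A r s (a ⊗ₜ[k] b) =
      s • ((b * a) ⊗ₜ[k] (1 : A)) + r • ((1 : A) ⊗ₜ[k] (b * a)) - s • (b ⊗ₜ[k] a) := by
  simp [W]

/-- `Z (c ⊗ d) = t ε(c) Δ(d) + p ε(d) Δ(c) - p (d ⊗ c)`. -/
def Z (C : Type*) [AddCommGroup C] [Module k C] [Coalgebra k C] (p t : k) :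
    C ⊗[k] C →ₗ[k] C ⊗[k] C :=
  t • (Coalgebra.comul (R := k) (A := C) ∘ₗ (TensorProduct.lid k C).toLinearMap ∘ₗ
      (Coalgebra.counit (R := k) (A := C)).rTensor C) +
    p • (Coalgebra.comul (R := k) (A := C) ∘ₗ (TensorProduct.rid k C).toLinearMap ∘ₗ
      (Coalgebra.counit (R := k) (A := C)).lTensor C) -
    p • (TensorProduct.comm k C C).toLinearMap

theorem Z_tmul {C : Type*} [AddCommGroup C] [Module k C] [Coalgebra k C] (p t : k) (c d : C) :
    Z C p t (c ⊗ₜ[k] d) =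
      (t * Coalgebra.counit (R := k) c) • Coalgebra.comul (R := k) d +
        (p * Coalgebra.counit (R := k) d) • Coalgebra.comul (R := k) c -
        p • (d ⊗ₜ[k] c) := by
  simp [Z, mul_smul]

end Operators

section Glue

variable {k V V' : Type*} [Field k] [AddCommGroup V] [Module k V] [AddCommGroup V'] [Module k V']

/-- The operator on `(V ⊕ V') ⊗ (V ⊕ V')` equal to `R` on `V ⊗ V`, to `R'` on `V' ⊗ V'`, to `ψ⁻¹` on
`V ⊗ V'` and to `ψ + (q - q⁻¹) I` on `V' ⊗ V`. The direct sum is the product `V × V'`; the four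
blocks are picked out by the projections and put back by the inclusions. -/
def glue (q : k) (R : V ⊗[k] V →ₗ[k] V ⊗[k] V) (R' : V' ⊗[k] V' →ₗ[k] V' ⊗[k] V')
    (ψ : V' ⊗[k] V ≃ₗ[k] V ⊗[k] V') :
    (V × V') ⊗[k] (V × V') →ₗ[k] (V × V') ⊗[k] (V × V') :=
  TensorProduct.map (LinearMap.inl k V V') (LinearMap.inl k V V') ∘ₗ R ∘ₗ
      TensorProduct.map (LinearMap.fst k V V') (LinearMap.fst k V V') +
    TensorProduct.map (LinearMap.inr k V V') (LinearMap.inr k V V') ∘ₗ R' ∘ₗ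
      TensorProduct.map (LinearMap.snd k V V') (LinearMap.snd k V V') +
    TensorProduct.map (LinearMap.inr k V V') (LinearMap.inl k V V') ∘ₗ ψ.symm.toLinearMap ∘ₗ
      TensorProduct.map (LinearMap.fst k V V') (LinearMap.snd k V V') +
    (TensorProduct.map (LinearMap.inl k V V') (LinearMap.inr k V V') ∘ₗ ψ.toLinearMap +
        (q - q⁻¹) • TensorProduct.map (LinearMap.inr k V V') (LinearMap.inl k V V')) ∘ₗ
      TensorProduct.map (LinearMap.snd k V V') (LinearMap.fst k V V')

variable (q : k) (R : V ⊗[k] V →ₗ[k] V ⊗[k] V) (R' : V' ⊗[k] V' →ₗ[k] V' ⊗[k] V')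
  (ψ : V' ⊗[k] V ≃ₗ[k] V ⊗[k] V')

theorem glue_inl_inl (x y : V) :
    glue q R R' ψ ((x, 0) ⊗ₜ[k] (y, 0)) =
      TensorProduct.map (LinearMap.inl k V V') (LinearMap.inl k V V') (R (x ⊗ₜ[k] y)) := by
  simp [glue]

theorem glue_inr_inr (x y : V') :
    glue q R R' ψ ((0, x) ⊗ₜ[k] (0, y)) =
      TensorProduct.map (LinearMap.inr k V V') (LinearMap.inr k V V') (R' (x ⊗ₜ[k] y)) := by
  simp [glue]

theorem glue_inl_inr (x : V) (y : V') :
    glue q R R' ψ ((x, 0) ⊗ₜ[k] (0, y)) =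
      TensorProduct.map (LinearMap.inr k V V') (LinearMap.inl k V V') (ψ.symm (x ⊗ₜ[k] y)) := by
  simp [glue]

theorem glue_inr_inl (y : V') (x : V) :
    glue q R R' ψ ((0, y) ⊗ₜ[k] (x, 0)) =
      TensorProduct.map (LinearMap.inl k V V') (LinearMap.inr k V V') (ψ (y ⊗ₜ[k] x)) +
        (q - q⁻¹) • ((0, y) ⊗ₜ[k] (x, 0)) := by
  simp [glue]

end Glue

end YBEntwining

end

/-! Put `h = q - q⁻¹`. Everything reduces to the relation `T² = h T + 1` and the braid equation: the
relation gives the inverse `T - h` and, expanded, the Hecke identity. Both diagonal blocks have the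
form `u ∘ m - q⁻¹` with `m ∘ u = q + q⁻¹`: on `A`, `m` is the product and `u(x) = q⁻¹ x ⊗ 1 + q 1 ⊗
x`; on `C`, `u` is the coproduct and `m` is `counitMix`. Hence both satisfy the same quadratic
relation, and both are braided. On the span of `A ⊗ C` and `C ⊗ A` the relation needs only that `ψ`
and `ψ⁻¹` are mutually inverse (`glue_glue`). The braid equation splits into eight blocks
(`glue_braid`). Blocks of one type are the braid equations of `R` and `R'`. Mixed blocks say that
`ψ` slides past `R` (`IsEntwining.leg12_W_comm`, from the product and unit axioms) and past `R'`
(`IsEntwining.leg23_Z_comm`, from the coproduct and counit axioms); the extra `h` terms cancel by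
the quadratic relations. -/

namespace YBEntwining

/-! ### Operators on two adjacent legs of a triple tensor product with varying factors. -/

section Legs

variable {k : Type*} [CommRing k]
variable {U U' V V' X X' : Type*} [AddCommGroup U] [Module k U] [AddCommGroup U'] [Module k U']
  [AddCommGroup V] [Module k V] [AddCommGroup V'] [Module k V']
  [AddCommGroup X] [Module k X] [AddCommGroup X'] [Module k X']

/-- `f ⊗ I`. -/
noncomputable def leg12 (X : Type*) [AddCommGroup X] [Module k X]
    (f : U ⊗[k] V →ₗ[k] U' ⊗[k] V') : (U ⊗[k] V) ⊗[k] X →ₗ[k] (U' ⊗[k] V') ⊗[k] X :=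
  f.rTensor X

/-- `I ⊗ f`, for the left bracketing. -/
noncomputable def leg23 (U : Type*) [AddCommGroup U] [Module k U]
    (f : V ⊗[k] X →ₗ[k] V' ⊗[k] X') : (U ⊗[k] V) ⊗[k] X →ₗ[k] (U ⊗[k] V') ⊗[k] X' :=
  (TensorProduct.assoc k U V' X').symm.toLinearMap ∘ₗ f.lTensor U ∘ₗ
    (TensorProduct.assoc k U V X).toLinearMap

@[simp]
theorem leg12_tmul (f : U ⊗[k] V →ₗ[k] U' ⊗[k] V') (w : U ⊗[k] V) (x : X) :
    leg12 X f (w ⊗ₜ x) = f w ⊗ₜ x := rfl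

@[simp]
theorem leg23_tmul (f : V ⊗[k] X →ₗ[k] V' ⊗[k] X') (u : U) (v : V) (x : X) :
    leg23 U f ((u ⊗ₜ v) ⊗ₜ x) = (TensorProduct.assoc k U V' X').symm (u ⊗ₜ f (v ⊗ₜ x)) := rfl

theorem leg23_assoc_symm (f : V ⊗[k] X →ₗ[k] V' ⊗[k] X') (u : U) (w : V ⊗[k] X) :
    leg23 U f ((TensorProduct.assoc k U V X).symm (u ⊗ₜ w)) =
      (TensorProduct.assoc k U V' X').symm (u ⊗ₜ f w) := by
  simp [leg23]

theorem leg12_leg12_of_comp_eq_id {f : U ⊗[k] V →ₗ[k] U' ⊗[k] V'}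
    {g : U' ⊗[k] V' →ₗ[k] U ⊗[k] V} (h : ∀ w, g (f w) = w) (w : (U ⊗[k] V) ⊗[k] X) :
    leg12 X g (leg12 X f w) = w := by
  have : g ∘ₗ f = LinearMap.id := LinearMap.ext h
  rw [leg12, leg12, ← LinearMap.comp_apply, ← LinearMap.rTensor_comp, this]
  simp

theorem leg23_leg23_of_comp_eq_id {f : V ⊗[k] X →ₗ[k] V' ⊗[k] X'}
    {g : V' ⊗[k] X' →ₗ[k] V ⊗[k] X} (h : ∀ w, g (f w) = w) (w : (U ⊗[k] V) ⊗[k] X) :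
    leg23 U g (leg23 U f w) = w := by
  have : g ∘ₗ f = LinearMap.id := LinearMap.ext h
  simp only [leg23, LinearMap.comp_apply, LinearEquiv.coe_coe, LinearEquiv.apply_symm_apply]
  rw [← LinearMap.comp_apply (LinearMap.lTensor U g), ← LinearMap.lTensor_comp, this]
  simp

theorem leg12_leg12_of_quadratic {f : U ⊗[k] V →ₗ[k] U ⊗[k] V} {h : k}
    (hf : ∀ w, f (f w) = h • f w + w) (w : (U ⊗[k] V) ⊗[k] X) :
    leg12 X f (leg12 X f w) = h • leg12 X f w + w := by
  induction w using TensorProduct.induction_on with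
  | zero => simp
  | add a b ha hb => simp only [map_add, ha, hb, smul_add]; abel
  | tmul w x => simp [hf, TensorProduct.add_tmul, TensorProduct.smul_tmul']

theorem leg23_leg23_of_quadratic {f : V ⊗[k] X →ₗ[k] V ⊗[k] X} {h : k}
    (hf : ∀ w, f (f w) = h • f w + w) (w : (U ⊗[k] V) ⊗[k] X) :
    leg23 U f (leg23 U f w) = h • leg23 U f w + w := by
  obtain ⟨w, rfl⟩ := (TensorProduct.assoc k U V X).symm.surjective w
  induction w using TensorProduct.induction_on with
  | zero => simp
  | add a b ha hb => simp only [map_add, ha, hb, smul_add]; abel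
  | tmul u w => simp only [leg23_assoc_symm, hf, TensorProduct.tmul_add, TensorProduct.tmul_smul,
      map_add, map_smul]

end Legs

/-! ### Invertibility and the Hecke identity from the quadratic relation. -/

section Quadratic

variable {k M : Type*} [Field k] [AddCommGroup M] [Module k M]

theorem bijective_of_quadratic {T : M →ₗ[k] M} {h : k} (hT : T ∘ₗ T = h • T + LinearMap.id) :
    Function.Bijective T := by
  have hT' (w) : T (T w) = h • T w + w := LinearMap.congr_fun hT w
  refine Function.bijective_iff_has_inverse.2 ⟨fun w => T w - h • w, fun w => ?_, fun w => ?_⟩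
  · simp [hT']
  · simp [hT']

theorem hecke_of_quadratic {T : M →ₗ[k] M} {q : k} (hq : q ≠ 0)
    (hT : T ∘ₗ T = (q - q⁻¹) • T + LinearMap.id) :
    (T + q⁻¹ • LinearMap.id) ∘ₗ (T - q • LinearMap.id) = 0 := by
  ext w
  have hT' (w) : T (T w) = (q - q⁻¹) • T w + w := LinearMap.congr_fun hT w
  simp only [LinearMap.comp_apply, LinearMap.add_apply, LinearMap.sub_apply, LinearMap.smul_apply,
    LinearMap.id_apply, LinearMap.zero_apply, map_sub, map_smul, hT']
  match_scalars <;> field_simp <;> ring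

end Quadratic

/-! ### Restriction of `act12` and `act23` to blocks of a direct sum. -/

section Act

variable {k : Type*} [Field k]
variable {E : Type*} [AddCommGroup E] [Module k E]
variable {U U' V V' X X' : Type*} [AddCommGroup U] [Module k U] [AddCommGroup U'] [Module k U']
  [AddCommGroup V] [Module k V] [AddCommGroup V'] [Module k V']
  [AddCommGroup X] [Module k X] [AddCommGroup X'] [Module k X']

/-- The `h` term accommodates the block `C ⊗ A`, whose image has two components; the other blocks
use `h = 0`. -/
theorem act12_map_of_comp_eq {T : E ⊗[k] E →ₗ[k] E ⊗[k] E} {i : U →ₗ[k] E} {j : V →ₗ[k] E}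
    {i' : U' →ₗ[k] E} {j' : V' →ₗ[k] E} {f : U ⊗[k] V →ₗ[k] U' ⊗[k] V'} {h : k}
    (hT : ∀ w, T (TensorProduct.map i j w) =
      TensorProduct.map i' j' (f w) + h • TensorProduct.map i j w)
    (l : X →ₗ[k] E) (w : (U ⊗[k] V) ⊗[k] X) :
    act12 T (TensorProduct.map (TensorProduct.map i j) l w) =
      TensorProduct.map (TensorProduct.map i' j') l (leg12 X f w) +
        h • TensorProduct.map (TensorProduct.map i j) l w := by
  induction w using TensorProduct.induction_on with
  | zero => simp
  | add a b ha hb => simp only [map_add, ha, hb, smul_add]; abel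
  | tmul w x => simp [act12, hT, TensorProduct.add_tmul, TensorProduct.smul_tmul']

theorem assoc_symm_tmul_map (i : U →ₗ[k] E) (j : V →ₗ[k] E) (l : X →ₗ[k] E) (u : U)
    (w : V ⊗[k] X) :
    TensorProduct.map (TensorProduct.map i j) l ((TensorProduct.assoc k U V X).symm (u ⊗ₜ w)) =
      (TensorProduct.assoc k E E E).symm (i u ⊗ₜ TensorProduct.map j l w) := by
  induction w using TensorProduct.induction_on with
  | zero => simp
  | add a b ha hb => simp only [TensorProduct.tmul_add, map_add, ha, hb]
  | tmul v x => simp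

theorem act23_map_of_comp_eq {T : E ⊗[k] E →ₗ[k] E ⊗[k] E} {j : V →ₗ[k] E} {l : X →ₗ[k] E}
    {j' : V' →ₗ[k] E} {l' : X' →ₗ[k] E} {f : V ⊗[k] X →ₗ[k] V' ⊗[k] X'} {h : k}
    (hT : ∀ w, T (TensorProduct.map j l w) =
      TensorProduct.map j' l' (f w) + h • TensorProduct.map j l w)
    (i : U →ₗ[k] E) (w : (U ⊗[k] V) ⊗[k] X) :
    act23 T (TensorProduct.map (TensorProduct.map i j) l w) =
      TensorProduct.map (TensorProduct.map i j') l' (leg23 U f w) +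
        h • TensorProduct.map (TensorProduct.map i j) l w := by
  obtain ⟨w, rfl⟩ := (TensorProduct.assoc k U V X).symm.surjective w
  induction w using TensorProduct.induction_on with
  | zero => simp
  | add a b ha hb => simp only [map_add, ha, hb, smul_add]; abel
  | tmul u w =>
    simp only [leg23_assoc_symm, assoc_symm_tmul_map]
    simp [act23, hT, TensorProduct.tmul_add]

end Act

/-! ### Quadratic relation and braid equation for the glued operator. -/

section GlueBlocks

variable {k V V' : Type*} [Field k] [AddCommGroup V] [Module k V] [AddCommGroup V'] [Module k V']
variable (q : k) (R : V ⊗[k] V →ₗ[k] V ⊗[k] V) (R' : V' ⊗[k] V' →ₗ[k] V' ⊗[k] V')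
  (ψ : V' ⊗[k] V ≃ₗ[k] V ⊗[k] V')

open LinearMap (inl inr)

theorem glue_map_inl_inl (w : V ⊗[k] V) :
    glue q R R' ψ (TensorProduct.map (inl k V V') (inl k V V') w) =
      TensorProduct.map (inl k V V') (inl k V V') (R w) := by
  induction w using TensorProduct.induction_on with
  | zero => simp
  | add a b ha hb => simp only [map_add, ha, hb]
  | tmul x y => simp [glue]

theorem glue_map_inr_inr (w : V' ⊗[k] V') :
    glue q R R' ψ (TensorProduct.map (inr k V V') (inr k V V') w) =
      TensorProduct.map (inr k V V') (inr k V V') (R' w) := by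
  induction w using TensorProduct.induction_on with
  | zero => simp
  | add a b ha hb => simp only [map_add, ha, hb]
  | tmul x y => simp [glue]

theorem glue_map_inl_inr (w : V ⊗[k] V') :
    glue q R R' ψ (TensorProduct.map (inl k V V') (inr k V V') w) =
      TensorProduct.map (inr k V V') (inl k V V') (ψ.symm w) := by
  induction w using TensorProduct.induction_on with
  | zero => simp
  | add a b ha hb => simp only [map_add, ha, hb]
  | tmul x y => simp [glue]

theorem glue_map_inr_inl (w : V' ⊗[k] V) :
    glue q R R' ψ (TensorProduct.map (inr k V V') (inl k V V') w) =
      TensorProduct.map (inl k V V') (inr k V V') (ψ w) +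
        (q - q⁻¹) • TensorProduct.map (inr k V V') (inl k V V') w := by
  induction w using TensorProduct.induction_on with
  | zero => simp
  | add a b ha hb => simp only [map_add, ha, hb, smul_add]; abel
  | tmul x y => simp [glue]

variable {q R R' ψ}

/-- The off-diagonal part is the matrix with rows `(0, ψ)` and `(ψ⁻¹, h)`, whose square is `h` times
itself plus the identity for any invertible `ψ`. -/
theorem glue_glue (hR : ∀ w, R (R w) = (q - q⁻¹) • R w + w)
    (hR' : ∀ w, R' (R' w) = (q - q⁻¹) • R' w + w) :
    glue q R R' ψ ∘ₗ glue q R R' ψ = (q - q⁻¹) • glue q R R' ψ + LinearMap.id := by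
  have h1 (w) : glue q R R' ψ (glue q R R' ψ (TensorProduct.map (inl k V V') (inl k V V') w)) =
      (q - q⁻¹) • glue q R R' ψ (TensorProduct.map (inl k V V') (inl k V V') w) +
        TensorProduct.map (inl k V V') (inl k V V') w := by
    simp only [glue_map_inl_inl, hR, map_add, map_smul]
  have h2 (w) : glue q R R' ψ (glue q R R' ψ (TensorProduct.map (inr k V V') (inr k V V') w)) =
      (q - q⁻¹) • glue q R R' ψ (TensorProduct.map (inr k V V') (inr k V V') w) +
        TensorProduct.map (inr k V V') (inr k V V') w := by
    simp only [glue_map_inr_inr, hR', map_add, map_smul]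
  have h3 (w) : glue q R R' ψ (glue q R R' ψ (TensorProduct.map (inl k V V') (inr k V V') w)) =
      (q - q⁻¹) • glue q R R' ψ (TensorProduct.map (inl k V V') (inr k V V') w) +
        TensorProduct.map (inl k V V') (inr k V V') w := by
    simp only [glue_map_inr_inl, glue_map_inl_inr, LinearEquiv.apply_symm_apply]
    abel
  have h4 (w) : glue q R R' ψ (glue q R R' ψ (TensorProduct.map (inr k V V') (inl k V V') w)) =
      (q - q⁻¹) • glue q R R' ψ (TensorProduct.map (inr k V V') (inl k V V') w) +
        TensorProduct.map (inr k V V') (inl k V V') w := by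
    simp only [glue_map_inr_inl, glue_map_inl_inr, LinearEquiv.symm_apply_apply, map_add, map_smul]
    abel
  ext x y
  · exact h1 (x ⊗ₜ y)
  · exact h3 (x ⊗ₜ y)
  · exact h4 (x ⊗ₜ y)
  · exact h2 (x ⊗ₜ y)

theorem glue_braid (hR : ∀ w, R (R w) = (q - q⁻¹) • R w + w)
    (hR' : ∀ w, R' (R' w) = (q - q⁻¹) • R' w + w)
    (bR : ∀ w, leg12 V R (leg23 V R (leg12 V R w)) = leg23 V R (leg12 V R (leg23 V R w)))
    (bR' : ∀ w, leg12 V' R' (leg23 V' R' (leg12 V' R' w)) =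
      leg23 V' R' (leg12 V' R' (leg23 V' R' w)))
    (nR : ∀ w, leg12 V' R (leg23 V ψ.toLinearMap (leg12 V ψ.toLinearMap w)) =
      leg23 V ψ.toLinearMap (leg12 V ψ.toLinearMap (leg23 V' R w)))
    (nR' : ∀ w, leg23 V R' (leg12 V' ψ.toLinearMap (leg23 V' ψ.toLinearMap w)) =
      leg12 V' ψ.toLinearMap (leg23 V' ψ.toLinearMap (leg12 V R' w))) :
    act12 (glue q R R' ψ) ∘ₗ act23 (glue q R R' ψ) ∘ₗ act12 (glue q R R' ψ) =
      act23 (glue q R R' ψ) ∘ₗ act12 (glue q R R' ψ) ∘ₗ act23 (glue q R R' ψ) := by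
  -- The zero multiples put all four blocks into the shape required by `act12_map_of_comp_eq` and
  -- `act23_map_of_comp_eq`.
  have g1 (w) : glue q R R' ψ (TensorProduct.map (inl k V V') (inl k V V') w) =
      TensorProduct.map (inl k V V') (inl k V V') (R w) +
        (0 : k) • TensorProduct.map (inl k V V') (inl k V V') w := by simp [glue_map_inl_inl]
  have g2 (w) : glue q R R' ψ (TensorProduct.map (inr k V V') (inr k V V') w) =
      TensorProduct.map (inr k V V') (inr k V V') (R' w) +
        (0 : k) • TensorProduct.map (inr k V V') (inr k V V') w := by simp [glue_map_inr_inr]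
  have g3 (w) : glue q R R' ψ (TensorProduct.map (inl k V V') (inr k V V') w) =
      TensorProduct.map (inr k V V') (inl k V V') (ψ.symm.toLinearMap w) +
        (0 : k) • TensorProduct.map (inl k V V') (inr k V V') w := by simp [glue_map_inl_inr]
  have g4 (w) : glue q R R' ψ (TensorProduct.map (inr k V V') (inl k V V') w) =
      TensorProduct.map (inl k V V') (inr k V V') (ψ.toLinearMap w) +
        (q - q⁻¹) • TensorProduct.map (inr k V V') (inl k V V') w := glue_map_inr_inl q R R' ψ w
  have t12V (w) :=
    leg12_leg12_of_comp_eq_id (X := V) (g := ψ.toLinearMap) (f := ψ.symm.toLinearMap) (by simp) w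
  have t12V' (w) :=
    leg12_leg12_of_comp_eq_id (X := V') (g := ψ.toLinearMap) (f := ψ.symm.toLinearMap) (by simp) w
  have s12V (w) :=
    leg12_leg12_of_comp_eq_id (X := V) (f := ψ.toLinearMap) (g := ψ.symm.toLinearMap) (by simp) w
  have s12V' (w) :=
    leg12_leg12_of_comp_eq_id (X := V') (f := ψ.toLinearMap) (g := ψ.symm.toLinearMap) (by simp) w
  have t23V (w) :=
    leg23_leg23_of_comp_eq_id (U := V) (g := ψ.toLinearMap) (f := ψ.symm.toLinearMap) (by simp) w
  have t23V' (w) :=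
    leg23_leg23_of_comp_eq_id (U := V') (g := ψ.toLinearMap) (f := ψ.symm.toLinearMap) (by simp) w
  have s23V (w) :=
    leg23_leg23_of_comp_eq_id (U := V) (f := ψ.toLinearMap) (g := ψ.symm.toLinearMap) (by simp) w
  have s23V' (w) :=
    leg23_leg23_of_comp_eq_id (U := V') (f := ψ.toLinearMap) (g := ψ.symm.toLinearMap) (by simp) w
  -- Moving one or both copies of `ψ` in `nR` and `nR'` across the equation yields the versions for
  -- the other positions of the odd factor.
  have nRmid (w) : leg12 V ψ.toLinearMap (leg23 V' R (leg12 V ψ.symm.toLinearMap w)) =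
      leg23 V ψ.symm.toLinearMap (leg12 V' R (leg23 V ψ.toLinearMap w)) := by
    have := nR (leg12 V ψ.symm.toLinearMap w)
    rw [t12V] at this
    rw [this, s23V]
  have nRinv (w) : leg12 V ψ.symm.toLinearMap (leg23 V ψ.symm.toLinearMap (leg12 V' R w)) =
      leg23 V' R (leg12 V ψ.symm.toLinearMap (leg23 V ψ.symm.toLinearMap w)) := by
    have := nRmid (leg23 V ψ.symm.toLinearMap w)
    rw [t23V] at this
    rw [← this, s12V]
  have nRmid' (w) : leg23 V' ψ.toLinearMap (leg12 V R' (leg23 V' ψ.symm.toLinearMap w)) =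
      leg12 V' ψ.symm.toLinearMap (leg23 V R' (leg12 V' ψ.toLinearMap w)) := by
    have := nR' (leg23 V' ψ.symm.toLinearMap w)
    rw [t23V'] at this
    rw [this, s12V']
  have nRinv' (w) : leg23 V' ψ.symm.toLinearMap (leg12 V' ψ.symm.toLinearMap (leg23 V R' w)) =
      leg12 V R' (leg23 V' ψ.symm.toLinearMap (leg12 V' ψ.symm.toLinearMap w)) := by
    have := nRmid' (leg12 V' ψ.symm.toLinearMap w)
    rw [t12V'] at this
    rw [← this, s23V']
  -- Needed only on `V' ⊗ V ⊗ V` and `V' ⊗ V' ⊗ V`: there one side contains `h R²` (or `h R'²`), the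
  -- other `h² R + h` (or `h² R' + h`), the last `h` coming from `ψ⁻¹ ψ`.
  have sq23 (w) := leg23_leg23_of_quadratic (U := V') hR w
  have sq12 (w) := leg12_leg12_of_quadratic (X := V) hR' w
  ext x y z
  all_goals
    simp only [TensorProduct.AlgebraTensorModule.curry_apply, LinearMap.restrictScalars_self,
      TensorProduct.curry_apply, LinearMap.coe_comp, Function.comp_apply, ← TensorProduct.map_tmul,
      act12_map_of_comp_eq g1, act12_map_of_comp_eq g2, act12_map_of_comp_eq g3,
      act12_map_of_comp_eq g4, act23_map_of_comp_eq g1, act23_map_of_comp_eq g2,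
      act23_map_of_comp_eq g3, act23_map_of_comp_eq g4, zero_smul, add_zero, map_add, map_smul,
      smul_add, bR, bR', nR, nR', nRmid, nRinv, nRmid', nRinv', s12V, s23V', sq12, sq23]
  all_goals abel

end GlueBlocks

/-! ### The operator on `A ⊗ A` and its compatibility with `ψ`. -/

section Algebra

variable {k A C : Type*} [Field k] [Ring A] [Algebra k A] [AddCommGroup C] [Module k C]

theorem W_comm_tmul (r s : k) (a b : A) :
    (W A r s ∘ₗ (TensorProduct.comm k A A).toLinearMap) (a ⊗ₜ[k] b) =
      s • ((a * b) ⊗ₜ[k] (1 : A)) + r • ((1 : A) ⊗ₜ[k] (a * b)) - s • (a ⊗ₜ[k] b) := by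
  simp [W_tmul]

theorem W_comm_quadratic {q : k} (hq : q ≠ 0) (w : A ⊗[k] A) :
    (W A q q⁻¹ ∘ₗ (TensorProduct.comm k A A).toLinearMap)
        ((W A q q⁻¹ ∘ₗ (TensorProduct.comm k A A).toLinearMap) w) =
      (q - q⁻¹) • (W A q q⁻¹ ∘ₗ (TensorProduct.comm k A A).toLinearMap) w + w := by
  induction w using TensorProduct.induction_on with
  | zero => simp
  | add a b ha hb => simp only [map_add, ha, hb, smul_add]; abel
  | tmul a b =>
    simp only [W_comm_tmul, map_add, map_sub, map_smul, mul_one, one_mul]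
    match_scalars <;> field_simp <;> ring

theorem W_comm_braid {q : k} (hq : q ≠ 0) (w : (A ⊗[k] A) ⊗[k] A) :
    leg12 A (W A q q⁻¹ ∘ₗ (TensorProduct.comm k A A).toLinearMap)
        (leg23 A (W A q q⁻¹ ∘ₗ (TensorProduct.comm k A A).toLinearMap)
          (leg12 A (W A q q⁻¹ ∘ₗ (TensorProduct.comm k A A).toLinearMap) w)) =
      leg23 A (W A q q⁻¹ ∘ₗ (TensorProduct.comm k A A).toLinearMap)
        (leg12 A (W A q q⁻¹ ∘ₗ (TensorProduct.comm k A A).toLinearMap)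
          (leg23 A (W A q q⁻¹ ∘ₗ (TensorProduct.comm k A A).toLinearMap) w)) := by
  induction w using TensorProduct.induction_on with
  | zero => simp
  | add a b ha hb => simp only [map_add, ha, hb]
  | tmul w c =>
  induction w using TensorProduct.induction_on with
  | zero => simp
  | add a b ha hb => simp only [TensorProduct.add_tmul, map_add, ha, hb]
  | tmul a b =>
    simp only [leg12_tmul, leg23_tmul, W_comm_tmul, map_add, map_sub, map_smul, mul_one, one_mul,
      TensorProduct.add_tmul, TensorProduct.sub_tmul, TensorProduct.tmul_add,
      TensorProduct.tmul_sub, ← TensorProduct.smul_tmul', TensorProduct.tmul_smul,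
      TensorProduct.assoc_symm_tmul, mul_assoc]
    match_scalars <;> field_simp <;> ring

theorem leg23_leg12_tmul_one {ψ : C ⊗[k] A →ₗ[k] A ⊗[k] C}
    (h1 : ∀ c : C, ψ (c ⊗ₜ[k] (1 : A)) = (1 : A) ⊗ₜ[k] c) (c : C) (a : A) :
    leg23 A ψ (leg12 A ψ ((c ⊗ₜ a) ⊗ₜ (1 : A))) =
      ((TensorProduct.mk k A A).flip 1).rTensor C (ψ (c ⊗ₜ a)) := by
  rw [leg12_tmul]
  induction ψ (c ⊗ₜ a) using TensorProduct.induction_on with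
  | zero => simp
  | add a b ha hb => simp only [TensorProduct.add_tmul, map_add, ha, hb]
  | tmul a c => simp [h1]

theorem leg23_leg12_one_tmul {ψ : C ⊗[k] A →ₗ[k] A ⊗[k] C}
    (h1 : ∀ c : C, ψ (c ⊗ₜ[k] (1 : A)) = (1 : A) ⊗ₜ[k] c) (c : C) (a : A) :
    leg23 A ψ (leg12 A ψ ((c ⊗ₜ (1 : A)) ⊗ₜ a)) =
      (TensorProduct.mk k A A 1).rTensor C (ψ (c ⊗ₜ a)) := by
  rw [leg12_tmul, h1, leg23_tmul]
  induction ψ (c ⊗ₜ a) using TensorProduct.induction_on with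
  | zero => simp
  | add a b ha hb => simp only [TensorProduct.tmul_add, map_add, ha, hb]
  | tmul a c => simp

/-- Factoring through the product for arbitrary `w` allows `w` to be an output of `ψ`, which is not
a pure tensor. -/
theorem leg12_W_comm (r s : k) (w : (A ⊗[k] A) ⊗[k] C) :
    leg12 C (W A r s ∘ₗ (TensorProduct.comm k A A).toLinearMap) w =
      s • ((TensorProduct.mk k A A).flip 1).rTensor C ((LinearMap.mul' k A).rTensor C w) +
        r • (TensorProduct.mk k A A 1).rTensor C ((LinearMap.mul' k A).rTensor C w) - s • w := by
  induction w using TensorProduct.induction_on with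
  | zero => simp
  | add a b ha hb => simp only [map_add, ha, hb, smul_add]; abel
  | tmul w c =>
  induction w using TensorProduct.induction_on with
  | zero => simp
  | add a b ha hb => simp only [TensorProduct.add_tmul, map_add, ha, hb, smul_add]; abel
  | tmul a b =>
    simp [W_tmul, TensorProduct.add_tmul, TensorProduct.sub_tmul, TensorProduct.smul_tmul']

variable [Coalgebra k C]

/-- The operator is built from the product, insertion of a unit and the identity, and moving `C`
past two factors of `A` respects each of them. -/
theorem IsEntwining.leg12_W_comm {ψ : C ⊗[k] A →ₗ[k] A ⊗[k] C} (hψ : IsEntwining ψ) (r s : k)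
    (w : (C ⊗[k] A) ⊗[k] A) :
    leg12 C (W A r s ∘ₗ (TensorProduct.comm k A A).toLinearMap) (leg23 A ψ (leg12 A ψ w)) =
      leg23 A ψ (leg12 A ψ
        (leg23 C (W A r s ∘ₗ (TensorProduct.comm k A A).toLinearMap) w)) := by
  induction w using TensorProduct.induction_on with
  | zero => simp
  | add a b ha hb => simp only [map_add, ha, hb]
  | tmul w b =>
  induction w using TensorProduct.induction_on with
  | zero => simp
  | add a b ha hb => simp only [TensorProduct.add_tmul, map_add, ha, hb]
  | tmul c a =>
    have hm : (LinearMap.mul' k A).rTensor C (leg23 A ψ (leg12 A ψ ((c ⊗ₜ a) ⊗ₜ b))) =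
        ψ (c ⊗ₜ (a * b)) := by
      have := LinearMap.congr_fun hψ.mul (c ⊗ₜ (a ⊗ₜ b))
      simp only [LinearMap.comp_apply, LinearMap.lTensor_tmul, LinearMap.mul'_apply] at this
      exact this.symm
    rw [YBEntwining.leg12_W_comm, hm, leg23_tmul, W_comm_tmul]
    simp only [TensorProduct.tmul_add, TensorProduct.tmul_sub, TensorProduct.tmul_smul, map_add,
      map_sub, map_smul, TensorProduct.assoc_symm_tmul, leg23_leg12_tmul_one hψ.one,
      leg23_leg12_one_tmul hψ.one]

end Algebra

/-! ### The operator on `C ⊗ C` and its compatibility with `ψ`. -/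

section Coalgebra

variable {k A C : Type*} [Field k] [AddCommGroup C] [Module k C] [Coalgebra k C]

open Coalgebra (comul counit)

/-- `c ⊗ d ↦ p ε(c) d + t ε(d) c`. -/
noncomputable def counitMix (C : Type*) [AddCommGroup C] [Module k C] [Coalgebra k C] (p t : k) :
    C ⊗[k] C →ₗ[k] C :=
  t • ((TensorProduct.rid k C).toLinearMap ∘ₗ (counit (R := k) (A := C)).lTensor C) +
    p • ((TensorProduct.lid k C).toLinearMap ∘ₗ (counit (R := k) (A := C)).rTensor C)

theorem counitMix_tmul (p t : k) (c d : C) :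
    counitMix C p t (c ⊗ₜ[k] d) = (t * counit (R := k) d) • c + (p * counit (R := k) c) • d := by
  simp [counitMix, mul_smul]

theorem counitMix_comul (p t : k) (c : C) :
    counitMix C p t (comul (R := k) c) = (t + p) • c := by
  simp [counitMix, add_smul]

theorem Z_comm_apply (p t : k) (w : C ⊗[k] C) :
    (Z C p t ∘ₗ (TensorProduct.comm k C C).toLinearMap) w =
      comul (R := k) (counitMix C p t w) - p • w := by
  induction w using TensorProduct.induction_on with
  | zero => simp
  | add a b ha hb => simp only [map_add, ha, hb, smul_add]; abel
  | tmul c d => simp [Z_tmul, counitMix_tmul]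

theorem Z_comm_quadratic {q : k} (hq : q ≠ 0) (w : C ⊗[k] C) :
    (Z C q⁻¹ q ∘ₗ (TensorProduct.comm k C C).toLinearMap)
        ((Z C q⁻¹ q ∘ₗ (TensorProduct.comm k C C).toLinearMap) w) =
      (q - q⁻¹) • (Z C q⁻¹ q ∘ₗ (TensorProduct.comm k C C).toLinearMap) w + w := by
  simp only [Z_comm_apply, map_sub, map_smul, counitMix_comul]
  match_scalars <;> field_simp <;> ring

theorem leg12_Z_comm (p t : k) (w : (C ⊗[k] C) ⊗[k] C) :
    leg12 C (Z C p t ∘ₗ (TensorProduct.comm k C C).toLinearMap) w =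
      leg12 C (comul (R := k) (A := C) ∘ₗ counitMix C p t) w - p • w := by
  induction w using TensorProduct.induction_on with
  | zero => simp
  | add a b ha hb => simp only [map_add, ha, hb, smul_add]; abel
  | tmul c d =>
    rw [leg12_tmul, Z_comm_apply, TensorProduct.sub_tmul, leg12_tmul, TensorProduct.smul_tmul',
      LinearMap.comp_apply]

theorem leg23_Z_comm {U : Type*} [AddCommGroup U] [Module k U] (p t : k)
    (w : (U ⊗[k] C) ⊗[k] C) :
    leg23 U (Z C p t ∘ₗ (TensorProduct.comm k C C).toLinearMap) w =
      leg23 U (comul (R := k) (A := C) ∘ₗ counitMix C p t) w - p • w := by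
  obtain ⟨w, rfl⟩ := (TensorProduct.assoc k U C C).symm.surjective w
  induction w using TensorProduct.induction_on with
  | zero => simp
  | add a b ha hb => simp only [map_add, ha, hb, smul_add]; abel
  | tmul c d =>
    rw [leg23_assoc_symm, Z_comm_apply, TensorProduct.tmul_sub, TensorProduct.tmul_smul,
      leg23_assoc_symm, LinearMap.comp_apply, map_sub, map_smul]

/-- Stated for a general `w` in order to be applied to a coproduct, where coassociativity and the
counit law simplify the two terms. -/
theorem leg23_comul_counitMix_tmul (p t : k) (w : C ⊗[k] C) (x : C) :
    leg23 C (comul (R := k) (A := C) ∘ₗ counitMix C p t) (w ⊗ₜ x) =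
      (t * counit (R := k) x) •
          (TensorProduct.assoc k C C C).symm ((comul (R := k) (A := C)).lTensor C w) +
        p • (TensorProduct.assoc k C C C).symm
          (TensorProduct.rid k C ((counit (R := k) (A := C)).lTensor C w) ⊗ₜ comul (R := k) x) := by
  induction w using TensorProduct.induction_on with
  | zero => simp
  | add a b ha hb => simp only [TensorProduct.add_tmul, map_add, ha, hb, smul_add]; abel
  | tmul c d =>
    simp [counitMix_tmul, TensorProduct.tmul_add, TensorProduct.tmul_smul, mul_smul,
      ← TensorProduct.smul_tmul']

theorem leg12_comul_counitMix_assoc_symm_tmul (p t : k) (x : C) (w : C ⊗[k] C) :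
    leg12 C (comul (R := k) (A := C) ∘ₗ counitMix C p t)
        ((TensorProduct.assoc k C C C).symm (x ⊗ₜ w)) =
      (p * counit (R := k) x) • (comul (R := k) (A := C)).rTensor C w +
        t • (comul (R := k) x ⊗ₜ
          TensorProduct.lid k C ((counit (R := k) (A := C)).rTensor C w)) := by
  induction w using TensorProduct.induction_on with
  | zero => simp
  | add a b ha hb => simp only [TensorProduct.tmul_add, map_add, ha, hb, smul_add]; abel
  | tmul c d =>
    simp only [TensorProduct.assoc_symm_tmul, leg12_tmul, LinearMap.comp_apply, counitMix_tmul,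
      map_add, map_smul, TensorProduct.add_tmul, LinearMap.rTensor_tmul, TensorProduct.lid_tmul,
      TensorProduct.tmul_smul, mul_smul, ← TensorProduct.smul_tmul']
    abel

theorem assoc_symm_lTensor_comul (c : C) :
    (TensorProduct.assoc k C C C).symm ((comul (R := k) (A := C)).lTensor C (comul (R := k) c)) =
      (comul (R := k) (A := C)).rTensor C (comul (R := k) c) := by
  rw [LinearEquiv.symm_apply_eq, Coalgebra.coassoc_apply]

theorem leg12_comul_counitMix_rTensor (p t : k) (w : C ⊗[k] C) :
    leg12 C (comul (R := k) (A := C) ∘ₗ counitMix C p t)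
        ((comul (R := k) (A := C)).rTensor C w) =
      (t + p) • (comul (R := k) (A := C)).rTensor C w := by
  induction w using TensorProduct.induction_on with
  | zero => simp
  | add a b ha hb => simp only [map_add, ha, hb, smul_add]
  | tmul c d => simp [counitMix_comul, TensorProduct.smul_tmul']

theorem leg23_comul_counitMix_lTensor (p t : k) (w : C ⊗[k] C) :
    leg23 C (comul (R := k) (A := C) ∘ₗ counitMix C p t)
        ((TensorProduct.assoc k C C C).symm ((comul (R := k) (A := C)).lTensor C w)) =
      (t + p) • (TensorProduct.assoc k C C C).symm ((comul (R := k) (A := C)).lTensor C w) := by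
  induction w using TensorProduct.induction_on with
  | zero => simp
  | add a b ha hb => simp only [map_add, ha, hb, smul_add]
  | tmul c d => simp [leg23_assoc_symm, counitMix_comul, TensorProduct.tmul_smul]

theorem Z_comm_braid {q : k} (hq : q ≠ 0) (w : (C ⊗[k] C) ⊗[k] C) :
    leg12 C (Z C q⁻¹ q ∘ₗ (TensorProduct.comm k C C).toLinearMap)
        (leg23 C (Z C q⁻¹ q ∘ₗ (TensorProduct.comm k C C).toLinearMap)
          (leg12 C (Z C q⁻¹ q ∘ₗ (TensorProduct.comm k C C).toLinearMap) w)) =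
      leg23 C (Z C q⁻¹ q ∘ₗ (TensorProduct.comm k C C).toLinearMap)
        (leg12 C (Z C q⁻¹ q ∘ₗ (TensorProduct.comm k C C).toLinearMap)
          (leg23 C (Z C q⁻¹ q ∘ₗ (TensorProduct.comm k C C).toLinearMap) w)) := by
  induction w using TensorProduct.induction_on with
  | zero => simp
  | add a b ha hb => simp only [map_add, ha, hb]
  | tmul w x =>
  induction w using TensorProduct.induction_on with
  | zero => simp
  | add a b ha hb => simp only [TensorProduct.add_tmul, map_add, ha, hb]
  | tmul c d =>
    -- On the image of the coproduct, `comul ∘ counitMix` is the scalar `q + q⁻¹`.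
    have e12 (u : C) (y : C) :
        leg12 C (comul (R := k) (A := C) ∘ₗ counitMix C q⁻¹ q) (comul (R := k) u ⊗ₜ y) =
          (q + q⁻¹) • (comul (R := k) u ⊗ₜ[k] y) := by
      simpa using leg12_comul_counitMix_rTensor q⁻¹ q (u ⊗ₜ[k] y)
    have e23 (u : C) (y : C) :
        leg23 C (comul (R := k) (A := C) ∘ₗ counitMix C q⁻¹ q)
            ((TensorProduct.assoc k C C C).symm (y ⊗ₜ comul (R := k) u)) =
          (q + q⁻¹) • (TensorProduct.assoc k C C C).symm (y ⊗ₜ comul (R := k) u) := by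
      simpa using leg23_comul_counitMix_lTensor q⁻¹ q (y ⊗ₜ[k] u)
    -- Coassociativity exhibits the iterated coproduct as a coproduct in the last two legs too.
    have e23' (u : C) :
        leg23 C (comul (R := k) (A := C) ∘ₗ counitMix C q⁻¹ q)
            ((comul (R := k) (A := C)).rTensor C (comul (R := k) u)) =
          (q + q⁻¹) • (comul (R := k) (A := C)).rTensor C (comul (R := k) u) := by
      rw [← assoc_symm_lTensor_comul, leg23_comul_counitMix_lTensor]
    have s12 : leg12 C (comul (R := k) (A := C) ∘ₗ counitMix C q⁻¹ q) ((c ⊗ₜ[k] d) ⊗ₜ[k] x) =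
        (q * counit (R := k) d) • (comul (R := k) c ⊗ₜ[k] x) +
          (q⁻¹ * counit (R := k) c) • (comul (R := k) d ⊗ₜ[k] x) := by
      simp only [leg12_tmul, LinearMap.comp_apply, counitMix_tmul, map_add, map_smul,
        TensorProduct.add_tmul, TensorProduct.smul_tmul']
    have s23 : leg23 C (comul (R := k) (A := C) ∘ₗ counitMix C q⁻¹ q) ((c ⊗ₜ[k] d) ⊗ₜ[k] x) =
        (q * counit (R := k) x) •
            (TensorProduct.assoc k C C C).symm (c ⊗ₜ[k] comul (R := k) d) +
          (q⁻¹ * counit (R := k) d) •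
            (TensorProduct.assoc k C C C).symm (c ⊗ₜ[k] comul (R := k) x) := by
      simp only [leg23_tmul, LinearMap.comp_apply, counitMix_tmul, map_add, map_smul,
        TensorProduct.tmul_add, TensorProduct.tmul_smul]
    simp only [leg12_Z_comm, leg23_Z_comm]
    simp only [map_add, map_sub, map_smul, s12, s23, e12, e23, e23',
      leg23_comul_counitMix_tmul, leg12_comul_counitMix_assoc_symm_tmul,
      assoc_symm_lTensor_comul, leg12_comul_counitMix_rTensor,
      Coalgebra.lTensor_counit_comul, Coalgebra.rTensor_counit_comul, TensorProduct.rid_tmul,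
      TensorProduct.lid_tmul, one_smul]
    match_scalars <;> field_simp <;> ring

variable [Ring A] [Algebra k A]

theorem IsEntwining.lTensor_counit {ψ : C ⊗[k] A →ₗ[k] A ⊗[k] C} (hψ : IsEntwining ψ)
    (c : C) (a : A) :
    TensorProduct.rid k A ((Coalgebra.counit (R := k) (A := C)).lTensor A (ψ (c ⊗ₜ a))) =
      Coalgebra.counit (R := k) c • a := by
  simpa using LinearMap.congr_fun hψ.counit (c ⊗ₜ a)

/-- Applying the counit to a `C` leg that has crossed `A` undoes the crossing, by the counit axiom,
so only the `ψ` of the surviving leg remains. -/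
theorem IsEntwining.lTensor_counitMix {ψ : C ⊗[k] A →ₗ[k] A ⊗[k] C} (hψ : IsEntwining ψ)
    (p t : k) (c d : C) (a : A) :
    (counitMix C p t).lTensor A
        (TensorProduct.assoc k A C C (leg12 C ψ (leg23 C ψ ((c ⊗ₜ d) ⊗ₜ a)))) =
      ψ (counitMix C p t (c ⊗ₜ d) ⊗ₜ a) := by
  have h1 (w : A ⊗[k] C) : (counitMix C p t).lTensor A (TensorProduct.assoc k A C C
      (leg12 C ψ ((TensorProduct.assoc k C A C).symm (c ⊗ₜ w)))) =
      t • ψ (c ⊗ₜ TensorProduct.rid k A ((Coalgebra.counit (R := k) (A := C)).lTensor A w)) +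
        (p * Coalgebra.counit (R := k) c) • w := by
    induction w using TensorProduct.induction_on with
    | zero => simp
    | add a b ha hb => simp only [TensorProduct.tmul_add, map_add, ha, hb, smul_add]; abel
    | tmul a d =>
      have h2 (w : A ⊗[k] C) : (counitMix C p t).lTensor A (TensorProduct.assoc k A C C
          (w ⊗ₜ d)) = (t * Coalgebra.counit (R := k) d) • w +
            p • (TensorProduct.rid k A
              ((Coalgebra.counit (R := k) (A := C)).lTensor A w) ⊗ₜ[k] d) := by
        induction w using TensorProduct.induction_on with
        | zero => simp
        | add a b ha hb =>
          simp only [TensorProduct.add_tmul, map_add, ha, hb, smul_add]; abel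
        | tmul a c =>
          simp [counitMix_tmul, TensorProduct.tmul_add, mul_smul, TensorProduct.smul_tmul']
      simp only [TensorProduct.assoc_symm_tmul, leg12_tmul, h2, hψ.lTensor_counit]
      simp [mul_smul, ← TensorProduct.smul_tmul']
  rw [leg23_tmul, h1, hψ.lTensor_counit, counitMix_tmul]
  simp [TensorProduct.add_tmul, mul_smul, ← TensorProduct.smul_tmul']

theorem IsEntwining.leg12_leg23_comul {ψ : C ⊗[k] A →ₗ[k] A ⊗[k] C} (hψ : IsEntwining ψ)
    (c : C) (a : A) :
    leg12 C ψ (leg23 C ψ (Coalgebra.comul (R := k) c ⊗ₜ a)) =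
      (TensorProduct.assoc k A C C).symm
        ((Coalgebra.comul (R := k) (A := C)).lTensor A (ψ (c ⊗ₜ a))) := by
  rw [LinearEquiv.eq_symm_apply]
  exact (LinearMap.congr_fun hψ.comul (c ⊗ₜ a)).symm

/-- Dual to `IsEntwining.leg12_W_comm`: two crossings followed by `counitMix` become one, and the
coproduct axiom splits that one into two again. -/
theorem IsEntwining.leg23_Z_comm {ψ : C ⊗[k] A →ₗ[k] A ⊗[k] C} (hψ : IsEntwining ψ) (p t : k)
    (w : (C ⊗[k] C) ⊗[k] A) :
    leg23 A (Z C p t ∘ₗ (TensorProduct.comm k C C).toLinearMap) (leg12 C ψ (leg23 C ψ w)) =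
      leg12 C ψ (leg23 C ψ
        (leg12 A (Z C p t ∘ₗ (TensorProduct.comm k C C).toLinearMap) w)) := by
  induction w using TensorProduct.induction_on with
  | zero => simp
  | add a b ha hb => simp only [map_add, ha, hb]
  | tmul w b =>
  induction w using TensorProduct.induction_on with
  | zero => simp
  | add a b ha hb => simp only [TensorProduct.add_tmul, map_add, ha, hb]
  | tmul c d =>
    rw [YBEntwining.leg23_Z_comm, leg12_tmul, Z_comm_apply, TensorProduct.sub_tmul, map_sub,
      map_sub, hψ.leg12_leg23_comul, ← hψ.lTensor_counitMix, ← TensorProduct.smul_tmul', map_smul,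
      map_smul, ← LinearMap.comp_apply (LinearMap.lTensor A _), ← LinearMap.lTensor_comp]
    rfl

end Coalgebra

end YBEntwining

theorem proposition2p9 {k A C : Type*} [Field k] [Ring A] [Algebra k A]
    [AddCommGroup C] [Module k C] [Coalgebra k C]
    (ψ : C ⊗[k] A →ₗ[k] A ⊗[k] C) (hψ : YBEntwining.IsEntwining ψ)
    (hbij : Function.Bijective ψ) (q : k) (hq : q ≠ 0) (r s p t : k)
    (hr : r = q) (ht : t = q) (hs : s = q⁻¹) (hp : p = q⁻¹) :
    YBEntwining.IsHeckeOperator q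
      (YBEntwining.glue q
        (YBEntwining.W A r s ∘ₗ (TensorProduct.comm k A A).toLinearMap)
        (YBEntwining.Z C p t ∘ₗ (TensorProduct.comm k C C).toLinearMap)
        (LinearEquiv.ofBijective ψ hbij)) := by
  subst hr ht hs hp
  have hquad := YBEntwining.glue_glue (ψ := LinearEquiv.ofBijective ψ hbij)
    (YBEntwining.W_comm_quadratic (A := A) hq) (YBEntwining.Z_comm_quadratic (C := C) hq)
  have hbraid := YBEntwining.glue_braid (ψ := LinearEquiv.ofBijective ψ hbij)
    (YBEntwining.W_comm_quadratic (A := A) hq) (YBEntwining.Z_comm_quadratic (C := C) hq)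
    (YBEntwining.W_comm_braid hq) (YBEntwining.Z_comm_braid hq)
    (hψ.leg12_W_comm _ _) (hψ.leg23_Z_comm _ _)
  refine ⟨⟨?_, hbraid⟩, ?_⟩
  · exact YBEntwining.bijective_of_quadratic hquad
  · exact YBEntwining.hecke_of_quadratic hq hquad
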